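/- Let $C$ be a Cantor fan, that is, a metric space homeomorphic to the union of the straight line segments in the plane from $(0,0)$ to $(c,1)$, where $c$ ranges over the standard Cantor set in $[0,1]$. 1. There is a continuous map $f\colon C\to C$, which is not a homeomorphism, such that $(C,f)$ is (topologically) mixing and chaotic in the sense of Robinson, but not chaotic in the sense of Devaney; in particular, its set of periodic points is not dense in $C$. 2. There is a homeomorphism $h\colon C\to C$ such that $(C,h)$ is (topologically) mixing and chaotic in the sense of Robinson, but not chaotic in the sense of Devaney; in particular, its set of periodic points is not dense in $C$. Here, for a map $g$ on a metric space $(C,d)$: $g$ is transitive if for all non-empty open $U,V\subseteq C$ there is an integer $n\ge 0$ with $g^n(U)\cap V\ne\emptyset$; $g$ is mixing if for all non-empty open $U,V\subseteq C$ there is $n_0\geq 0$ with $g^n(U)\cap V\neq\emptyset$ for all $n\ge n_0$; $g$ has sensitive dependence on initial conditions if there is $\varepsilon>0$ such that for every $x\in C$ and $\delta>0$ there are $y$ with $d(x,y)<\delta$ and an integer $n\geq 1$ with $d(g^n(x),g^n(y))>\varepsilon$; $g$ is chaotic in the sense of Robinson if it is transitive and has sensitive dependence on initial conditions; and $g$ is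 chaotic in the sense of Devaney if it is transitive and its set of periodic points (points $p$ with $g^n(p)=p$ for some $n\ge1$) is dense in $C$. -/

import Mathlib

namespace FanChaos

/-- The standard Cantor fan: the union, over all points `c` of the standard Cantor set, of the
straight line segments in the plane from `(0, 0)` to `(c, 1)`. -/
def standardCantorFan : Set (ℝ × ℝ) :=
  ⋃ c ∈ cantorSet, segment ℝ ((0, 0) : ℝ × ℝ) (c, 1)

/-- A space is a Cantor fan if it is homeomorphic to the standard Cantor fan. -/
def IsCantorFan (X : Type*) [TopologicalSpace X] : Prop :=
  Nonempty (X ≃ₜ standardCantorFan)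

/-- `f` is transitive: for all non-empty open `U`, `V` some image `f^n(U)`, `n ≥ 0`, meets `V`. -/
def IsTransitive {X : Type*} [TopologicalSpace X] (f : X → X) : Prop :=
  ∀ U V : Set X, IsOpen U → U.Nonempty → IsOpen V → V.Nonempty →
    ∃ n : ℕ, ((f^[n] '' U) ∩ V).Nonempty

/-- `f` is (topologically) mixing: for all non-empty open `U`, `V`, all images `f^n(U)` with `n`
large enough meet `V`. -/
def IsMixing {X : Type*} [TopologicalSpace X] (f : X → X) : Prop :=
  ∀ U V : Set X, IsOpen U → U.Nonempty → IsOpen V → V.Nonempty →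
    ∃ n₀ : ℕ, ∀ n : ℕ, n₀ ≤ n → ((f^[n] '' U) ∩ V).Nonempty

/-- Sensitive dependence on initial conditions. -/
def IsSensitive {X : Type*} [MetricSpace X] (f : X → X) : Prop :=
  ∃ ε : ℝ, 0 < ε ∧ ∀ x : X, ∀ δ : ℝ, 0 < δ →
    ∃ y ∈ Metric.ball x δ, ∃ n : ℕ, 0 < n ∧ ε < dist (f^[n] x) (f^[n] y)

/-- Chaos in the sense of Robinson: transitivity and sensitive dependence on initial
conditions. -/
def IsRobinsonChaotic {X : Type*} [MetricSpace X] (f : X → X) : Prop :=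
  IsTransitive f ∧ IsSensitive f

/-- Chaos in the sense of Devaney: transitivity and density of the set of periodic points. -/
def IsDevaneyChaotic {X : Type*} [TopologicalSpace X] (f : X → X) : Prop :=
  IsTransitive f ∧ Dense (Function.periodicPts f)

end FanChaos

open Set Function Topology Filter

namespace FanChaos

/-! ### Consequences of mixing, and factors. -/

section Dynamics

variable {X Y : Type*}

/-! The fan is the cone over a full shift on four letters. Let the shift act on the base while the
fibre `[0, 1]` is moved by the flow `powerFlow`, for a time given by the letter at the origin: `0`,
`1`, `-1` or `√2`. The flow fixes the apex level, so this descends to the fan. Mixing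
(`isMixing_skew`, `isMixing_skew_shift_int`): the flow is transitive on `(0, 1)`, and a free block
of letters between two prescribed ones can have total weight near any real, at every large length.
Periodic points are not dense (`birkhoffSum_originWeight_ne_zero`): once the letter `√2` occurs, the
total weight is irrational, so no interior fibre point returns. The one-sided shift gives a
non-injective map, the two-sided shift a homeomorphism. -/

theorem IsMixing.isTransitive [TopologicalSpace X] {f : X → X} (hf : IsMixing f) :
    IsTransitive f := fun U V hU hU' hV hV' ↦
  let ⟨n, hn⟩ := hf U V hU hU' hV hV'
  ⟨n, hn n le_rfl⟩

theorem IsMixing.isSensitive [MetricSpace X] [Nontrivial X] {f : X → X} (hf : IsMixing f) :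
    IsSensitive f := by
  obtain ⟨p, q, hpq⟩ := exists_pair_ne X
  have hd : 0 < dist p q := dist_pos.2 hpq
  -- Were the orbits of `y` and `z` both within a quarter of that of `x`, four quarters would
  -- strictly exceed `dist p q`.
  refine ⟨dist p q / 4, by positivity, fun x δ hδ ↦ ?_⟩
  have hball : ∀ z : X, ∃ n₀ : ℕ, ∀ n, n₀ ≤ n →
      ((f^[n] '' Metric.ball x δ) ∩ Metric.ball z (dist p q / 4)).Nonempty := fun z ↦
    hf _ _ Metric.isOpen_ball ⟨x, Metric.mem_ball_self hδ⟩ Metric.isOpen_ball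
      ⟨z, Metric.mem_ball_self (by positivity)⟩
  obtain ⟨m₁, h₁⟩ := hball p
  obtain ⟨m₂, h₂⟩ := hball q
  set n := m₁ + m₂ + 1
  obtain ⟨_, ⟨y, hy, rfl⟩, hyp⟩ := h₁ n (by omega)
  obtain ⟨_, ⟨z, hz, rfl⟩, hzq⟩ := h₂ n (by omega)
  rw [Metric.mem_ball] at hyp hzq
  by_contra! hcon
  have hxy := hcon y hy n (by omega)
  have hxz := hcon z hz n (by omega)
  have t₁ := dist_triangle4 p (f^[n] y) (f^[n] z) q
  have t₂ := dist_triangle_left (f^[n] y) (f^[n] z) (f^[n] x)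
  rw [dist_comm] at hyp
  linarith

theorem IsMixing.isRobinsonChaotic [MetricSpace X] [Nontrivial X] {f : X → X}
    (hf : IsMixing f) : IsRobinsonChaotic f :=
  ⟨hf.isTransitive, hf.isSensitive⟩

theorem IsMixing.of_semiconj [TopologicalSpace X] [TopologicalSpace Y] {F : Y → Y} {f : X → X}
    {π : Y → X} (hF : IsMixing F) (hπ : Continuous π) (hs : Surjective π)
    (h : Semiconj π F f) : IsMixing f := by
  intro U V hU hU' hV hV'
  obtain ⟨n₀, hn₀⟩ := hF (π ⁻¹' U) (π ⁻¹' V) (hU.preimage hπ) (hU'.preimage hs)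
    (hV.preimage hπ) (hV'.preimage hs)
  refine ⟨n₀, fun n hn ↦ ?_⟩
  obtain ⟨_, ⟨y, hy, rfl⟩, hyV⟩ := hn₀ n hn
  exact ⟨π (F^[n] y), ⟨π y, hy, ((h.iterate_right n) y).symm⟩, hyV⟩

end Dynamics

/-! ### A flow on the interval, transitive on the interior. -/

section Flow

/-- The flow `t ↦ t ^ exp s` on the unit interval, whose fixed points are `0` and `1`. -/
noncomputable def powerFlow (s : ℝ) (t : unitInterval) : unitInterval :=
  ⟨(t : ℝ) ^ Real.exp s, Real.rpow_nonneg t.2.1 _,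
    Real.rpow_le_one t.2.1 t.2.2 (Real.exp_pos s).le⟩

@[simp]
theorem coe_powerFlow (s : ℝ) (t : unitInterval) :
    (powerFlow s t : ℝ) = (t : ℝ) ^ Real.exp s := rfl

theorem continuous_powerFlow : Continuous fun p : ℝ × unitInterval ↦ powerFlow p.1 p.2 :=
  Continuous.subtype_mk
    ((continuous_subtype_val.comp continuous_snd).rpow (Real.continuous_exp.comp continuous_fst)
      fun p ↦ Or.inr (Real.exp_pos p.1)) _

@[simp]
theorem powerFlow_zero (t : unitInterval) : powerFlow 0 t = t := by
  ext; simp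

theorem powerFlow_add (r s : ℝ) (t : unitInterval) :
    powerFlow (r + s) t = powerFlow r (powerFlow s t) := by
  ext
  simp only [coe_powerFlow]
  rw [← Real.rpow_mul t.2.1, add_comm, Real.exp_add]

@[simp]
theorem powerFlow_apply_zero (s : ℝ) : powerFlow s 0 = 0 := by
  ext; simp [Real.zero_rpow (Real.exp_ne_zero s)]

@[simp]
theorem powerFlow_apply_one (s : ℝ) : powerFlow s 1 = 1 := by
  ext; simp

theorem eq_zero_of_powerFlow_eq {s : ℝ} {t : unitInterval} (ht : t ∈ Ioo 0 1)
    (h : powerFlow s t = t) : s = 0 := by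
  have h0 : (0 : ℝ) < t := ht.1
  have h1 : (t : ℝ) < 1 := ht.2
  have hl := congrArg (fun u : unitInterval ↦ Real.log u) h
  simp only [coe_powerFlow, Real.log_rpow h0] at hl
  exact Real.exp_eq_one_iff s |>.1 (mul_right_cancel₀ (Real.log_neg h0 h1).ne (by linarith))

theorem exists_powerFlow_eq {t u : unitInterval} (ht : t ∈ Ioo 0 1) (hu : u ∈ Ioo 0 1) :
    ∃ s, powerFlow s t = u := by
  have ht0 : (0 : ℝ) < t := ht.1
  have hu0 : (0 : ℝ) < u := hu.1
  have htl : Real.log t < 0 := Real.log_neg ht0 ht.2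
  have hul : Real.log u < 0 := Real.log_neg hu0 hu.2
  refine ⟨Real.log (Real.log u / Real.log t), ?_⟩
  ext
  rw [coe_powerFlow, Real.exp_log (div_pos_of_neg_of_neg hul htl), Real.rpow_def_of_pos ht0,
    mul_div_cancel₀ _ htl.ne, Real.exp_log hu0]

theorem exists_mem_Ioo_of_isOpen {W : Set unitInterval} (hW : IsOpen W) (hW' : W.Nonempty) :
    ∃ t ∈ W, t ∈ Ioo 0 1 := by
  have hd : Dense (Ioo (0 : unitInterval) 1) := by
    rw [dense_iff_closure_eq, closure_Ioo zero_ne_one]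
    exact eq_univ_of_forall fun t ↦ ⟨unitInterval.nonneg t, unitInterval.le_one t⟩
  exact hd.inter_open_nonempty W hW hW'

end Flow

/-! ### Skew products and a mixing criterion. -/

section Skew

variable {K : Type*}

/-- The skew product over `σ` acting on the fibres by the flow, for the time `s`. -/
noncomputable def skew (σ : K → K) (s : K → ℝ) (p : K × unitInterval) : K × unitInterval :=
  (σ p.1, powerFlow (s p.1) p.2)

theorem continuous_skew [TopologicalSpace K] {σ : K → K} {s : K → ℝ} (hσ : Continuous σ)
    (hs : Continuous s) : Continuous (skew σ s) :=
  (hσ.comp continuous_fst).prodMk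
    (continuous_powerFlow.comp ((hs.comp continuous_fst).prodMk continuous_snd))

theorem skew_iterate (σ : K → K) (s : K → ℝ) (n : ℕ) (p : K × unitInterval) :
    (skew σ s)^[n] p = (σ^[n] p.1, powerFlow (birkhoffSum σ s n p.1) p.2) := by
  induction n generalizing p with
  | zero => simp
  | succ n ih =>
    rw [iterate_succ_apply, ih, birkhoffSum_succ', add_comm (s p.1), powerFlow_add, iterate_succ_apply]
    rfl

/-- Some time `r` carries an interior point of one fibre set into the other, and nearby times do
too; so it suffices to hit the base target with Birkhoff sum near `r`. -/
theorem isMixing_skew [TopologicalSpace K] {σ : K → K} {s : K → ℝ}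
    (h : ∀ U V : Set K, IsOpen U → U.Nonempty → IsOpen V → V.Nonempty → ∀ r ε : ℝ, 0 < ε →
      ∃ n₀ : ℕ, ∀ n, n₀ ≤ n → ∃ x ∈ U, σ^[n] x ∈ V ∧ |birkhoffSum σ s n x - r| < ε) :
    IsMixing (skew σ s) := by
  have basic : ∀ A : Set (K × unitInterval), IsOpen A → A.Nonempty →
      ∃ (U : Set K) (t : unitInterval) (W : Set unitInterval), IsOpen U ∧ U.Nonempty ∧ IsOpen W ∧
        t ∈ W ∧ t ∈ Ioo 0 1 ∧ U ×ˢ W ⊆ A := by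
    rintro A hA ⟨⟨k, t⟩, hkt⟩
    obtain ⟨U, W, hU, hW, hk, ht, hUW⟩ := isOpen_prod_iff.1 hA k t hkt
    obtain ⟨t', ht', ht''⟩ := exists_mem_Ioo_of_isOpen hW ⟨t, ht⟩
    exact ⟨U, t', W, hU, ⟨k, hk⟩, hW, ht', ht'', hUW⟩
  intro A B hA hA' hB hB'
  obtain ⟨U, t, W, hU, hU', -, htW, ht, hUW⟩ := basic A hA hA'
  obtain ⟨V, u, T, hV, hV', hT, huT, hu, hVT⟩ := basic B hB hB'
  obtain ⟨r, rfl⟩ := exists_powerFlow_eq ht hu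
  have hc : Continuous fun r' ↦ powerFlow r' t :=
    continuous_powerFlow.comp (continuous_id.prodMk continuous_const)
  obtain ⟨ε, hε, hεT⟩ := Metric.isOpen_iff.1 (hT.preimage hc) r huT
  obtain ⟨n₀, hn₀⟩ := h U V hU hU' hV hV' r ε hε
  refine ⟨n₀, fun n hn ↦ ?_⟩
  obtain ⟨x, hxU, hxV, hx⟩ := hn₀ n hn
  refine ⟨_, ⟨(x, t), hUW ⟨hxU, htW⟩, rfl⟩, hVT ?_⟩
  rw [skew_iterate]
  exact ⟨hxV, hεT (by rwa [Metric.mem_ball, Real.dist_eq])⟩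

end Skew

/-! ### The full shift and its cocycle. -/

section Shift

/-- The shift map on sequences. -/
def shift {ι A : Type*} [Add ι] [One ι] (k : ι → A) : ι → A := fun i ↦ k (i + 1)

theorem shift_iterate_apply {ι A : Type*} [AddMonoidWithOne ι] (n : ℕ) (k : ι → A) (i : ι) :
    shift^[n] k i = k (i + n) := by
  induction n generalizing k with
  | zero => simp
  | succ n ih =>
    rw [iterate_succ_apply, ih, shift, Nat.cast_succ, add_assoc]

theorem continuous_shift {ι A : Type*} [Add ι] [One ι] [TopologicalSpace A] :
    Continuous (shift : (ι → A) → ι → A) :=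
  continuous_pi fun i ↦ continuous_apply (i + 1)

/-- The rational part of the weight of a letter. -/
def intWeight : Bool × Bool → ℤ
  | (true, false) => 1
  | (false, true) => -1
  | _ => 0

/-- The irrational part of the weight of a letter. -/
def natWeight : Bool × Bool → ℕ
  | (true, true) => 1
  | _ => 0

/-- The weights of the four letters are `0`, `1`, `-1` and `√2`. -/
noncomputable def weight (a : Bool × Bool) : ℝ := intWeight a + natWeight a * √2

/-- The multiples of `√2` are dense modulo `1`, and on the circle the natural multiples suffice. -/
theorem exists_int_add_nat_mul_near (r : ℝ) {ε : ℝ} (hε : 0 < ε) :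
    ∃ (p : ℤ) (q : ℕ), |(p + q * √2 : ℝ) - r| < ε := by
  have : Fact ((0 : ℝ) < 1) := ⟨one_pos⟩
  have hd : DenseRange (fun n : ℕ ↦ n • ((√2 : ℝ) : AddCircle (1 : ℝ))) :=
    denseRange_zsmul_iff_nsmul.1
      (AddCircle.denseRange_zsmul_coe_iff.2 (by simpa using irrational_sqrt_two))
  obtain ⟨q, x, hx, hxq⟩ := hd.exists_mem_open
    (QuotientAddGroup.isOpenMap_coe (Metric.ball r ε) Metric.isOpen_ball)
    ⟨_, r, Metric.mem_ball_self hε, rfl⟩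
  have hxq' : ((x - q • √2 : ℝ) : AddCircle (1 : ℝ)) = 0 := sub_eq_zero.2 hxq
  obtain ⟨p, hp⟩ := (AddCircle.coe_eq_zero_iff _).1 hxq'
  refine ⟨p, q, ?_⟩
  rw [zsmul_one, nsmul_eq_mul] at hp
  rwa [hp, sub_add_cancel, ← Real.dist_eq]

/-- The letter of weight `0` pads the word to any sufficient length; this is what gives mixing
rather than mere transitivity. -/
theorem exists_word_of_weight (p : ℤ) (q : ℕ) {m : ℕ} (hm : p.natAbs + q ≤ m) :
    ∃ w : ℕ → Bool × Bool, ∑ i ∈ Finset.range m, weight (w i) = p + q * √2 := by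
  have cons : ∀ (m : ℕ) (a : Bool × Bool) (r : ℝ),
      (∃ w : ℕ → Bool × Bool, ∑ i ∈ Finset.range m, weight (w i) = r) →
      ∃ w : ℕ → Bool × Bool, ∑ i ∈ Finset.range (m + 1), weight (w i) = r + weight a := by
    rintro m a r ⟨w, rfl⟩
    exact ⟨fun i ↦ Nat.casesOn i a w, Finset.sum_range_succ' _ _⟩
  induction m generalizing p q with
  | zero =>
    obtain ⟨rfl, rfl⟩ : p = 0 ∧ q = 0 := by omega
    exact ⟨fun _ ↦ (true, true), by simp⟩
  | succ m ih =>
    rcases q with _ | q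
    · rcases lt_trichotomy p 0 with hp | rfl | hp
      · convert cons m (false, true) _ (ih (p + 1) 0 (by omega)) using 3
        simp [weight, intWeight, natWeight]
      · convert cons m (false, false) _ (ih 0 0 (by omega)) using 3
        simp [weight, intWeight, natWeight]
      · convert cons m (true, false) _ (ih (p - 1) 0 (by omega)) using 3
        simp [weight, intWeight, natWeight]
    · convert cons m (true, true) _ (ih p q (by omega)) using 3
      simp [weight, intWeight, natWeight]
      ring

theorem exists_cylinder {A : Type*} [TopologicalSpace A] {U : Set (ℤ → A)}
    (hU : IsOpen U) {x : ℤ → A} (hx : x ∈ U) :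
    ∃ N : ℕ, ∀ z : ℤ → A, (∀ i : ℤ, -N ≤ i → i < N → z i = x i) → z ∈ U := by
  obtain ⟨I, u, hu, hIU⟩ := isOpen_pi_iff.1 hU x hx
  refine ⟨I.sup Int.natAbs + 1, fun z hz ↦ hIU fun i hi ↦ ?_⟩
  have : i.natAbs ≤ I.sup Int.natAbs := Finset.le_sup (f := Int.natAbs) hi
  rw [hz i (by omega) (by omega)]
  exact (hu i hi).2

/-- The cocycle on the shift space given by the weight of the letter at the origin. -/
noncomputable def originWeight {ι : Type*} [Zero ι] (k : ι → Bool × Bool) : ℝ := weight (k 0)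

theorem continuous_originWeight {ι : Type*} [Zero ι] :
    Continuous (originWeight : (ι → Bool × Bool) → ℝ) :=
  continuous_of_discreteTopology.comp (continuous_apply 0)

theorem isMixing_skew_shift_int :
    IsMixing (skew (shift : (ℤ → Bool × Bool) → ℤ → Bool × Bool) originWeight) := by
  refine isMixing_skew ?_
  rintro U V hU ⟨x, hx⟩ hV ⟨y, hy⟩ r ε hε
  obtain ⟨N₁, h₁⟩ := exists_cylinder hU hx
  obtain ⟨N₂, h₂⟩ := exists_cylinder hV hy
  set N := N₁ + N₂
  -- `c₁` and `c₂` are the contributions forced by the two cylinders; the middle word must supply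
  -- the rest of `r`.
  set c₁ := ∑ i ∈ Finset.range N, weight (x i)
  set c₂ := ∑ i ∈ Finset.range N, weight (y (i - N))
  obtain ⟨p, q, hpq⟩ := exists_int_add_nat_mul_near (r - c₁ - c₂) hε
  refine ⟨N + (p.natAbs + q) + N, fun n hn ↦ ?_⟩
  obtain ⟨m, rfl, hm⟩ : ∃ m, n = N + m + N ∧ p.natAbs + q ≤ m := ⟨n - 2 * N, by omega, by omega⟩
  obtain ⟨w, hw⟩ := exists_word_of_weight p q hm
  -- Follow `x`, then the free word, then `y` recentred at time `n`; `y` starts `N` places early so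
  -- that the past of its cylinder fits.
  let z : ℤ → Bool × Bool := fun i ↦
    if i < N then x i else if i < N + m then w (i - N).toNat else y (i - (N + m + N : ℕ))
  refine ⟨z, h₁ z fun i _ hi ↦ if_pos (by omega), h₂ _ fun i hi _ ↦ ?_, ?_⟩
  · rw [shift_iterate_apply]
    simp only [z]
    rw [if_neg (by push_cast; omega), if_neg (by push_cast; omega), add_sub_cancel_right]
  · have hz : birkhoffSum shift originWeight (N + m + N) z = c₁ + (p + q * √2) + c₂ := by
      simp only [birkhoffSum, originWeight, shift_iterate_apply, zero_add]
      rw [Finset.sum_range_add, Finset.sum_range_add, ← hw]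
      congr 2
      · refine Finset.sum_congr rfl fun i hi ↦ ?_
        rw [Finset.mem_range] at hi
        simp only [z]
        rw [if_pos (by omega)]
      · refine Finset.sum_congr rfl fun i hi ↦ ?_
        rw [Finset.mem_range] at hi
        simp only [z]
        rw [if_neg (by omega), if_pos (by omega)]
        congr 2
        omega
      · ext i
        simp only [z]
        rw [if_neg (by omega), if_neg (by omega)]
        congr 2
        push_cast
        ring
    rw [hz]
    convert hpq using 2
    ring

/-- Forgetting negative coordinates is a factor map, as the cocycle sees only coordinate `0`. -/
theorem isMixing_skew_shift_nat :
    IsMixing (skew (shift : (ℕ → Bool × Bool) → ℕ → Bool × Bool) originWeight) := by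
  refine isMixing_skew_shift_int.of_semiconj
    (π := fun p ↦ (fun i : ℕ ↦ p.1 i, p.2)) (by fun_prop) ?_ ?_
  · rintro ⟨k, t⟩
    exact ⟨(fun i ↦ k i.toNat, t), by simp⟩
  · rintro ⟨k, t⟩
    rfl

/-- No letter has a negative `√2` part, so the one at the origin cannot be cancelled. -/
theorem birkhoffSum_originWeight_ne_zero {ι : Type*} [AddMonoidWithOne ι] {k : ι → Bool × Bool}
    (hk : k 0 = (true, true)) {n : ℕ} (hn : 0 < n) :
    birkhoffSum shift originWeight n k ≠ 0 := by
  set p : ℤ := ∑ i ∈ Finset.range n, intWeight (k i)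
  set q : ℕ := ∑ i ∈ Finset.range n, natWeight (k i)
  have hsum : birkhoffSum shift originWeight n k = p + q * √2 := by
    simp only [birkhoffSum, originWeight, shift_iterate_apply, zero_add, weight, p, q]
    push_cast
    rw [Finset.sum_add_distrib, Finset.sum_mul]
  have hq : 0 < q := by
    refine Finset.sum_pos' (fun _ _ ↦ Nat.zero_le _) ⟨0, Finset.mem_range.2 hn, ?_⟩
    simp [hk, natWeight]
  rw [hsum]
  have := (irrational_sqrt_two.natCast_mul hq.ne').intCast_add p
  exact this.ne_zero

end Shift

/-! ### The fan as a cone, and induced maps. -/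

section Cone

variable {K X : Type*}

/-- A continuous surjection from `K × [0, 1]` which exhibits `X` as the cone over `K`, with apex
the image of `K × {0}`. -/
structure IsConeMap [TopologicalSpace K] [TopologicalSpace X] (π : K × unitInterval → X) :
    Prop where
  continuous : Continuous π
  surjective : Surjective π
  eq_iff : ∀ p q, π p = π q ↔ p.2 = q.2 ∧ (p.2 = 0 ∨ p.1 = q.1)

theorem exists_isConeMap [TopologicalSpace K] [TopologicalSpace X] (e : K ≃ₜ cantorSet)
    (hX : IsCantorFan X) : ∃ π : K × unitInterval → X, IsConeMap π := by
  obtain ⟨φ⟩ := hX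
  have hmem : ∀ p : K × unitInterval,
      (((p.2 : ℝ) * (e p.1 : ℝ), (p.2 : ℝ)) : ℝ × ℝ) ∈ standardCantorFan := fun p ↦ by
    refine mem_iUnion₂.2 ⟨e p.1, (e p.1).2, ?_⟩
    rw [segment_eq_image]
    exact ⟨p.2, p.2.2, by simp⟩
  refine ⟨fun p ↦ φ.symm ⟨_, hmem p⟩, ?_, ?_, ?_⟩
  · exact φ.symm.continuous.comp (Continuous.subtype_mk (by fun_prop) _)
  · refine φ.symm.surjective.comp ?_
    rintro ⟨x, hx⟩
    obtain ⟨c, hc, hxc⟩ := mem_iUnion₂.1 hx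
    rw [segment_eq_image] at hxc
    obtain ⟨t, ht, rfl⟩ := hxc
    exact ⟨(e.symm ⟨c, hc⟩, ⟨t, ht⟩), by simp⟩
  · intro p q
    rw [φ.symm.injective.eq_iff, Subtype.mk.injEq, Prod.mk.injEq]
    constructor
    · rintro ⟨h₁, h₂⟩
      refine ⟨Subtype.ext h₂, or_iff_not_imp_left.2 fun h0 ↦ e.injective (Subtype.ext ?_)⟩
      rw [← h₂] at h₁
      exact mul_left_cancel₀ (fun h ↦ h0 (Subtype.ext h)) h₁
    · rintro ⟨h₁, h₂ | h₂⟩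
      · simp [← h₁, h₂]
      · simp [h₁, h₂]

/-- The map of the cone induced by a skew product. -/
noncomputable def coneMap (π : K × unitInterval → X) (hπ : Surjective π) (σ : K → K)
    (s : K → ℝ) (x : X) : X := π (skew σ s (surjInv hπ x))

namespace IsConeMap

variable [TopologicalSpace K] [TopologicalSpace X] {π : K × unitInterval → X}

/-- The choice made by `surjInv` is ambiguous only at level `0`, which the flow fixes and `π`
collapses. -/
theorem semiconj (hπ : IsConeMap π) (σ : K → K) (s : K → ℝ) :
    Semiconj π (skew σ s) (coneMap π hπ.surjective σ s) := by
  intro p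
  have h := (hπ.eq_iff _ _).1 (surjInv_eq hπ.surjective (π p))
  refine ((hπ.eq_iff _ _).2 ?_).symm
  obtain ⟨h₁, h₂ | h₂⟩ := h
  · simp [skew, ← h₁, h₂]
  · simp [skew, h₁, h₂]

theorem isQuotientMap [CompactSpace K] [T2Space X] (hπ : IsConeMap π) : IsQuotientMap π :=
  hπ.continuous.isClosedMap.isQuotientMap hπ.continuous hπ.surjective

theorem continuous_coneMap [CompactSpace K] [T2Space X] (hπ : IsConeMap π) {σ : K → K}
    {s : K → ℝ} (hσ : Continuous σ) (hs : Continuous s) :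
    Continuous (coneMap π hπ.surjective σ s) := by
  rw [hπ.isQuotientMap.continuous_iff, ← (hπ.semiconj σ s).comp_eq]
  exact hπ.continuous.comp (continuous_skew hσ hs)

theorem coneMap_leftInverse (hπ : IsConeMap π) {σ τ : K → K} {s r : K → ℝ}
    (hτ : LeftInverse τ σ) (hr : ∀ k, r (σ k) + s k = 0) :
    LeftInverse (coneMap π hπ.surjective τ r) (coneMap π hπ.surjective σ s) := by
  intro x
  obtain ⟨⟨k, t⟩, rfl⟩ := hπ.surjective x
  rw [← hπ.semiconj σ s, ← hπ.semiconj τ r]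
  simp [skew, hτ k, ← powerFlow_add, hr]

theorem not_dense_periodicPts [CompactSpace K] [T2Space X] (hπ : IsConeMap π) {σ : K → K}
    {s : K → ℝ} {W : Set K} (hW : IsOpen W) (hW' : W.Nonempty)
    (h : ∀ k ∈ W, ∀ n, 0 < n → birkhoffSum σ s n k ≠ 0) :
    ¬ Dense (periodicPts (coneMap π hπ.surjective σ s)) := by
  intro hd
  -- Only level `0` is collapsed, so this set is saturated and its image is open.
  have hpre : π ⁻¹' (π '' (W ×ˢ Ioo 0 1)) = W ×ˢ Ioo 0 1 := by
    refine (subset_preimage_image _ _).antisymm' ?_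
    rintro ⟨k, t⟩ ⟨⟨k', t'⟩, ⟨hk', ht'⟩, heq⟩
    obtain ⟨h₁, h₂⟩ := (hπ.eq_iff _ _).1 heq
    obtain rfl : t' = t := h₁
    obtain rfl : k' = k := h₂.resolve_left ht'.1.ne'
    exact ⟨hk', ht'⟩
  have hopen : IsOpen (π '' (W ×ˢ Ioo 0 1)) := by
    rw [← hπ.isQuotientMap.isOpen_preimage, hpre]
    exact hW.prod isOpen_Ioo
  obtain ⟨t, -, ht⟩ := exists_mem_Ioo_of_isOpen isOpen_univ univ_nonempty
  obtain ⟨k, hk⟩ := hW'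
  obtain ⟨_, ⟨⟨k', t'⟩, ⟨hk', ht'⟩, rfl⟩, n, hn, hper⟩ :=
    hd.inter_open_nonempty _ hopen ⟨_, (k, t), ⟨hk, ht⟩, rfl⟩
  have heq := ((hπ.semiconj σ s).iterate_right n (k', t')).trans hper
  rw [skew_iterate] at heq
  exact h k' hk' n hn (eq_zero_of_powerFlow_eq ht' ((hπ.eq_iff _ _).1 heq).1)

theorem nontrivial [Nonempty K] (hπ : IsConeMap π) : Nontrivial X := by
  obtain ⟨k⟩ := ‹Nonempty K›
  refine ⟨π (k, 0), π (k, 1), fun h ↦ ?_⟩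
  exact zero_ne_one ((hπ.eq_iff _ _).1 h).1

/-- Level `1` is an invariant, uncollapsed copy of the base. -/
theorem not_injective_coneMap (hπ : IsConeMap π) {σ : K → K} (s : K → ℝ)
    (hσ : ¬ Injective σ) : ¬ Injective (coneMap π hπ.surjective σ s) := by
  intro hinj
  refine hσ fun k k' hk ↦ ?_
  have heq : π (k, 1) = π (k', 1) := by
    apply hinj
    rw [← hπ.semiconj σ s, ← hπ.semiconj σ s]
    simp [skew, hk]
  exact ((hπ.eq_iff _ _).1 heq).2.resolve_left one_ne_zero

end IsConeMap

end Cone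

/-! ### The two maps on the fan. -/

theorem nonempty_homeomorph_cantorSet (ι : Type*) [Infinite ι] [Countable ι] :
    Nonempty ((ι → Bool × Bool) ≃ₜ cantorSet) := by
  obtain ⟨e⟩ := nonempty_equiv_of_countable (α := ι × Bool) (β := ℕ)
  let φ : (ι → Bool × Bool) ≃ₜ (ι × Bool → Bool) :=
    { toFun := fun k p ↦ bif p.2 then (k p.1).1 else (k p.1).2
      invFun := fun k i ↦ (k (i, true), k (i, false))
      left_inv := fun k ↦ rfl
      right_inv := fun k ↦ by ext ⟨i, _ | _⟩ <;> rfl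
      continuous_toFun := continuous_pi fun ⟨i, b⟩ ↦ by cases b <;> simp <;> fun_prop
      continuous_invFun := by fun_prop }
  exact ⟨(φ.trans (Homeomorph.piCongrLeft (Y := fun _ ↦ Bool) e)).trans
    cantorSetHomeomorphNatToBool.symm⟩

theorem isOpen_origin_cylinder {ι : Type*} [Zero ι] :
    IsOpen {k : ι → Bool × Bool | k 0 = (true, true)} :=
  (isOpen_discrete {((true, true) : Bool × Bool)}).preimage
    (continuous_apply (A := fun _ : ι ↦ Bool × Bool) 0)

theorem not_injective_shift_nat : ¬ Injective (shift : (ℕ → Bool × Bool) → ℕ → Bool × Bool) := by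
  intro h
  have heq : shift (fun _ : ℕ ↦ (true, true)) =
      shift (fun i : ℕ ↦ if i = 0 then (false, false) else (true, true)) := by
    ext i <;> simp [shift]
  simpa using congrFun (h heq) 0

theorem exists_mixing_map {X : Type*} [MetricSpace X] (hX : IsCantorFan X) :
    ∃ f : X → X, Continuous f ∧ ¬ IsHomeomorph f ∧ IsMixing f ∧ IsRobinsonChaotic f ∧
      ¬ Dense (periodicPts f) := by
  obtain ⟨e⟩ := nonempty_homeomorph_cantorSet ℕ
  obtain ⟨π, hπ⟩ := exists_isConeMap e hX
  have := hπ.nontrivial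
  have hmix := isMixing_skew_shift_nat.of_semiconj hπ.continuous hπ.surjective
    (hπ.semiconj shift originWeight)
  exact ⟨_, hπ.continuous_coneMap continuous_shift continuous_originWeight,
    fun h ↦ hπ.not_injective_coneMap _ not_injective_shift_nat h.injective, hmix,
    hmix.isRobinsonChaotic, hπ.not_dense_periodicPts isOpen_origin_cylinder
      ⟨fun _ ↦ (true, true), rfl⟩ fun _ hk _ hn ↦ birkhoffSum_originWeight_ne_zero hk hn⟩

theorem exists_mixing_homeomorph {X : Type*} [MetricSpace X] (hX : IsCantorFan X) :
    ∃ h : X ≃ₜ X, IsMixing h ∧ IsRobinsonChaotic h ∧ ¬ Dense (periodicPts h) := by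
  obtain ⟨e⟩ := nonempty_homeomorph_cantorSet ℤ
  obtain ⟨π, hπ⟩ := exists_isConeMap e hX
  have := hπ.nontrivial
  have hmix := isMixing_skew_shift_int.of_semiconj hπ.continuous hπ.surjective
    (hπ.semiconj shift originWeight)
  let unshift : (ℤ → Bool × Bool) → ℤ → Bool × Bool := fun k i ↦ k (i - 1)
  have hcont : Continuous unshift := continuous_pi fun i ↦ continuous_apply (i - 1)
  let h : X ≃ₜ X :=
    { toFun := coneMap π hπ.surjective shift originWeight
      -- The time to undo was read off before shifting, hence the weight at `unshift k`.
      invFun := coneMap π hπ.surjective unshift fun k ↦ -originWeight (unshift k)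
      left_inv := hπ.coneMap_leftInverse (fun k ↦ by ext i <;> simp [shift, unshift])
        fun k ↦ by simp [shift, unshift, originWeight]
      right_inv := hπ.coneMap_leftInverse (fun k ↦ by ext i <;> simp [shift, unshift])
        fun k ↦ by simp
      continuous_toFun := hπ.continuous_coneMap continuous_shift continuous_originWeight
      continuous_invFun := hπ.continuous_coneMap hcont (continuous_originWeight.comp hcont).neg }
  exact ⟨h, hmix, hmix.isRobinsonChaotic, hπ.not_dense_periodicPts isOpen_origin_cylinder
    ⟨fun _ ↦ (true, true), rfl⟩ fun _ hk _ hn ↦ birkhoffSum_originWeight_ne_zero hk hn⟩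

end FanChaos

theorem mainTheorem3 {X : Type*} [MetricSpace X] (hX : FanChaos.IsCantorFan X) :
    (∃ f : X → X, Continuous f ∧ ¬ IsHomeomorph f ∧ FanChaos.IsMixing f ∧
      FanChaos.IsRobinsonChaotic f ∧ ¬ FanChaos.IsDevaneyChaotic f ∧
      ¬ Dense (Function.periodicPts f)) ∧
    (∃ h : X ≃ₜ X, FanChaos.IsMixing h ∧
      FanChaos.IsRobinsonChaotic h ∧ ¬ FanChaos.IsDevaneyChaotic h ∧
      ¬ Dense (Function.periodicPts h)) := by
  obtain ⟨f, hc, hn, hm, hr, hp⟩ := FanChaos.exists_mixing_map hX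
  obtain ⟨h, hm', hr', hp'⟩ := FanChaos.exists_mixing_homeomorph hX
  exact ⟨⟨f, hc, hn, hm, hr, fun hD ↦ hp hD.2, hp⟩, h, hm', hr', fun hD ↦ hp' hD.2, hp'⟩
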